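/- Let $V\in L^\infty(\mathbb R)$ be real-valued with $0<v_0\le V(x)\le v_1$ for a.e. $x\in\mathbb R$, for some constants $v_0,v_1$. Elements of $H^1(\mathbb R)$ are identified with their continuous representatives. For $u\in H^1(\mathbb R)$ put $\|u\|_V^2=\int_{\mathbb R}\bigl(|u'(x)|^2+V(x)|u(x)|^2\bigr)\,dx$, and for $a\in\mathbb R$ put $$K_a=\{u\in H^1(\mathbb R): u(a)=\|u\|_{L^\infty(\mathbb R)}=1\},\qquad F(a)=\inf_{u\in K_a}\|u\|_V^2 .$$ Then for every $a\in\mathbb R$ the infimum is attained at exactly one $u_a\in K_a$, so that $F(a)=\|u_a\|_V^2$, and $u_a$ has a right derivative $u_a'(a_+)$ and a left derivative $u_a'(a_-)$ at $a$. Moreover $F\in W^{2,\infty}_{loc}(\mathbb R)$, $F$ is differentiable at every point, and $$F(a)=u_a'(a_-)-u_a'(a_+)\quad(a\in\mathbb R),$$ $$F'(a)=|u_a'(a_+)|^2-|u_a'(a_-)|^2\quad(a\in\mathbb R),$$ $$F''(a)=2F(a)\bigl(|u_a'(a_+)|^2+u_a'(a_+)u_a'(a_-)+|u_a'(a_-)|^2-V(a)\bigr)\quad(\text{a.e.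 }a\in\mathbb R),$$ where the last formula holds both for the weak derivative of $F'$ and for the classical derivative of $F'$ at almost every point. If $V$ is continuous on $\mathbb R$, then $F\in C^2(\mathbb R)$. -/

import Mathlib

open MeasureTheory Set
open scoped ContDiff

noncomputable section

namespace SobolevPotential

/-- `g` is a weak (distributional) derivative of `f` on the real line. -/
def IsWeakDeriv (f g : ℝ → ℝ) : Prop :=
  LocallyIntegrable f volume ∧ LocallyIntegrable g volume ∧
    ∀ φ : ℝ → ℝ, ContDiff ℝ ∞ φ → HasCompactSupport φ →
      ∫ x, f x * deriv φ x = -∫ x, g x * φ x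

/-- The weak derivative is unique up to a null set. -/
theorem IsWeakDeriv.ae_eq {f g h : ℝ → ℝ} (hg : IsWeakDeriv f g) (hh : IsWeakDeriv f h) :
    g =ᵐ[volume] h := by
  refine ae_eq_of_integral_contDiff_smul_eq hg.2.1 hh.2.1 ?_
  intro φ hφ hc
  have h1 := hg.2.2 φ hφ hc
  have h2 := hh.2.2 φ hφ hc
  simp only [smul_eq_mul, mul_comm (φ _)]
  linarith

open Classical in
/-- A representative of the weak derivative of `f` (and `0` if `f` has none). -/
def weakDeriv (f : ℝ → ℝ) : ℝ → ℝ :=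
  if h : ∃ g, IsWeakDeriv f g then h.choose else 0

theorem IsWeakDeriv.weakDeriv {f g : ℝ → ℝ} (hg : IsWeakDeriv f g) :
    IsWeakDeriv f (weakDeriv f) := by
  have h : ∃ g, IsWeakDeriv f g := ⟨g, hg⟩
  rw [SobolevPotential.weakDeriv, dif_pos h]
  exact h.choose_spec

/-- The space `H¹(ℝ)`; its elements are identified with their continuous representatives. -/
def H1 : Set (ℝ → ℝ) :=
  {u | Continuous u ∧ MemLp u 2 volume ∧ ∃ g, IsWeakDeriv u g ∧ MemLp g 2 volume}

/-- `‖u‖_V² = ∫ (|u'|² + V |u|²)`. -/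
def normSqV (V u : ℝ → ℝ) : ℝ :=
  ∫ x, ((weakDeriv u x) ^ 2 + V x * (u x) ^ 2)

/-- `K_a = {u ∈ H¹(ℝ) : u(a) = ‖u‖_∞ = 1}`. -/
def K (a : ℝ) : Set (ℝ → ℝ) :=
  {u | u ∈ H1 ∧ u a = 1 ∧ eLpNorm u ⊤ volume = 1}

/-- `F(a) = inf_{u ∈ K_a} ‖u‖_V²`. -/
def F (V : ℝ → ℝ) (a : ℝ) : ℝ := sInf (normSqV V '' K a)

/-- `u` minimizes `‖·‖_V²` over `K_a`. -/
def IsMinimizer (V : ℝ → ℝ) (a : ℝ) (u : ℝ → ℝ) : Prop :=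
  u ∈ K a ∧ ∀ w ∈ K a, normSqV V u ≤ normSqV V w

/-- Membership in `L^∞_loc(ℝ)`. -/
def MemLinftyLoc (f : ℝ → ℝ) : Prop :=
  ∀ s : Set ℝ, IsCompact s → MemLp f ⊤ (volume.restrict s)

/-- Membership in `W^{2,∞}_loc(ℝ)` (for the continuous representative). -/
def MemW2inftyLoc (f : ℝ → ℝ) : Prop :=
  Continuous f ∧ ∃ g h : ℝ → ℝ, IsWeakDeriv f g ∧ IsWeakDeriv g h ∧
    MemLinftyLoc f ∧ MemLinftyLoc g ∧ MemLinftyLoc h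

end SobolevPotential

end

namespace SobolevPotential

open Filter Topology

/-! The Riccati equation `ρ' = V - ρ²` has two global solutions independent of `a`: `l` with values
in `[√v₀, √v₁]` and `r` with values in `[-√v₁, -√v₀]` (`exists_riccati`, `exists_riccati_neg`). For
`w ∈ H¹` with weak derivative `g`, completing the square gives `(ρ w²)' = g² + V w² - (g - ρ w)²`.
Integrating with `l` left of `a` and `r` right of `a`, and using `w a = 1`, gives `‖w‖_V² = l a - r
a + ∫_{x≤a} (g - l w)² + ∫_{x>a} (g - r w)²` (`normSqV_eq`).

Both squares vanish exactly for the function with logarithmic derivative `l` on the left and `r` on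
the right. As `l > 0 > r`, it peaks at `a` and decays exponentially, so it satisfies the sup-norm
constraint and is the unique minimizer. Its one-sided derivatives at `a` are `l a` and `r a`, and `F
= l - r`. The regularity of `F` and its derivative formulas follow by differentiating with the
Riccati equation. -/

/-! ### Absolutely continuous primitives and weak derivatives on the line. -/

theorem locallyIntegrable_of_intervalIntegrable {g : ℝ → ℝ}
    (h : ∀ a b, IntervalIntegrable g volume a b) : LocallyIntegrable g volume := fun x =>
  ⟨Ioc (x - 1) (x + 1), Ioc_mem_nhds (by linarith) (by linarith),
    (intervalIntegrable_iff_integrableOn_Ioc_of_le (by linarith)).1 (h _ _)⟩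

theorem intervalIntegrable_of_locallyIntegrable {g : ℝ → ℝ} (h : LocallyIntegrable g volume)
    (a b : ℝ) : IntervalIntegrable g volume a b :=
  intervalIntegrable_iff.2
    ((h.integrableOn_isCompact isCompact_uIcc).mono_set uIoc_subset_uIcc)

/-- `f` is a locally absolutely continuous primitive of `g`. -/
structure IsPrimitive (f g : ℝ → ℝ) : Prop where
  locallyIntegrable : LocallyIntegrable g volume
  integral_eq : ∀ a b, ∫ x in a..b, g x = f b - f a

namespace IsPrimitive

variable {f f' g g' : ℝ → ℝ}

theorem intervalIntegrable (h : IsPrimitive f g) (a b : ℝ) : IntervalIntegrable g volume a b :=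
  intervalIntegrable_of_locallyIntegrable h.locallyIntegrable a b

theorem of_base {a : ℝ} (hg : LocallyIntegrable g volume)
    (h : ∀ x, ∫ t in a..x, g t = f x - f a) : IsPrimitive f g where
  locallyIntegrable := hg
  integral_eq b c := by
    have hi := intervalIntegrable_of_locallyIntegrable hg
    rw [← intervalIntegral.integral_interval_sub_left (hi a c) (hi a b), h, h]
    ring

theorem integral (hg : LocallyIntegrable g volume) (a : ℝ) :
    IsPrimitive (fun x => ∫ t in a..x, g t) g :=
  of_base (a := a) hg (by simp)

theorem eq_add (h : IsPrimitive f g) (a : ℝ) : f = fun x => f a + ∫ t in a..x, g t := by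
  funext x
  rw [h.integral_eq]
  ring

theorem continuous (h : IsPrimitive f g) : Continuous f := by
  rw [h.eq_add 0]
  exact continuous_const.add (intervalIntegral.continuous_primitive h.intervalIntegrable 0)

theorem ae_hasDerivAt (h : IsPrimitive f g) : ∀ᵐ x, HasDerivAt f (g x) x := by
  rw [h.eq_add 0]
  filter_upwards [_root_.LocallyIntegrable.ae_hasDerivAt_integral h.locallyIntegrable] with x hx
  simpa using (hx 0).const_add (f 0)

theorem hasDerivAt (h : IsPrimitive f g) (hg : Continuous g) (x : ℝ) : HasDerivAt f (g x) x := by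
  rw [h.eq_add 0]
  exact (intervalIntegral.integral_hasDerivAt_right (h.intervalIntegrable 0 x)
    hg.aestronglyMeasurable.stronglyMeasurableAtFilter hg.continuousAt).const_add _

theorem absolutelyContinuousOnInterval (h : IsPrimitive f g) (a b : ℝ) :
    AbsolutelyContinuousOnInterval f a b := by
  have h1 := (h.intervalIntegrable a b).absolutelyContinuousOnInterval_intervalIntegral
    (c := a) left_mem_uIcc
  have h2 : AbsolutelyContinuousOnInterval (fun _ : ℝ => f a) a b :=
    ContDiffOn.absolutelyContinuousOnInterval contDiffOn_const
  rw [h.eq_add a]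
  exact h2.add h1

theorem of_absolutelyContinuousOnInterval (h : ∀ a b, AbsolutelyContinuousOnInterval f a b)
    (hd : ∀ᵐ x, HasDerivAt f (g x) x) : IsPrimitive f g := by
  have hae : deriv f =ᵐ[volume] g := hd.mono fun x hx => hx.deriv
  refine ⟨locallyIntegrable_of_intervalIntegrable fun a b => ?_, fun a b => ?_⟩
  · exact (h a b).intervalIntegrable_deriv.congr_ae (ae_restrict_of_ae hae)
  · rw [← (h a b).integral_deriv_eq_sub]
    exact intervalIntegral.integral_congr_ae (hae.mono fun x hx _ => hx.symm)

theorem of_hasDerivAt (h : ∀ x, HasDerivAt f (g x) x) (hg : Continuous g) : IsPrimitive f g :=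
  ⟨hg.locallyIntegrable, fun a b =>
    intervalIntegral.integral_eq_sub_of_hasDerivAt (fun x _ => h x) (hg.intervalIntegrable a b)⟩

theorem congr_ae (h : IsPrimitive f g) (hg : g =ᵐ[volume] g') : IsPrimitive f g' :=
  of_absolutelyContinuousOnInterval h.absolutelyContinuousOnInterval <| by
    filter_upwards [h.ae_hasDerivAt, hg] with x hx hx'
    rwa [← hx']

theorem sub (h : IsPrimitive f g) (h' : IsPrimitive f' g') :
    IsPrimitive (fun x => f x - f' x) (fun x => g x - g' x) where
  locallyIntegrable := h.locallyIntegrable.sub h'.locallyIntegrable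
  integral_eq a b := by
    rw [intervalIntegral.integral_sub (h.intervalIntegrable a b) (h'.intervalIntegrable a b),
      h.integral_eq, h'.integral_eq]
    ring

theorem mul (h : IsPrimitive f g) (h' : IsPrimitive f' g') :
    IsPrimitive (fun x => f x * f' x) (fun x => g x * f' x + f x * g' x) :=
  of_absolutelyContinuousOnInterval
    (fun a b => (h.absolutelyContinuousOnInterval a b).fun_mul
      (h'.absolutelyContinuousOnInterval a b)) <| by
    filter_upwards [h.ae_hasDerivAt, h'.ae_hasDerivAt] with x hx hx'
    exact hx.mul hx'

theorem comp_neg (h : IsPrimitive f g) : IsPrimitive (fun x => -f (-x)) (fun x => g (-x)) where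
  locallyIntegrable := locallyIntegrable_of_intervalIntegrable fun a b => by
    simpa using (IntervalIntegrable.iff_comp_neg).1 (h.intervalIntegrable (-a) (-b))
  integral_eq a b := by
    rw [intervalIntegral.integral_comp_neg, h.integral_eq]
    ring

/-- Gluing two primitives along a point where they agree. -/
theorem ite_le (h : IsPrimitive f g) (h' : IsPrimitive f' g') {a : ℝ} (ha : f a = f' a) :
    IsPrimitive (fun x => if x ≤ a then f x else f' x) (fun x => if x ≤ a then g x else g' x) := by
  refine of_base (a := a) ?_ fun x => ?_
  · rw [locallyIntegrable_iff]
    intro k hk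
    exact Integrable.piecewise (s := Iic a) measurableSet_Iic
      (h.locallyIntegrable.integrableOn_isCompact hk).integrableOn
      (h'.locallyIntegrable.integrableOn_isCompact hk).integrableOn
  · rcases le_or_gt x a with hx | hx
    · rw [if_pos hx, if_pos le_rfl, ← h.integral_eq]
      refine intervalIntegral.integral_congr_ae (Eventually.of_forall fun t ht => ?_)
      rw [uIoc_of_ge hx] at ht
      simp [ht.2]
    · rw [if_neg hx.not_ge, if_pos le_rfl, ha, ← h'.integral_eq]
      refine intervalIntegral.integral_congr_ae (Eventually.of_forall fun t ht => ?_)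
      rw [uIoc_of_le hx.le] at ht
      simp [ht.1]

/-- Integrability of `g` gives `f` a limit at infinity; integrability of `f` forces that limit to be
`0`. -/
theorem integral_Ioi (h : IsPrimitive f g) (hf : Integrable f) (hg : Integrable g) (a : ℝ) :
    ∫ x in Ioi a, g x = -f a := by
  have h1 := intervalIntegral_tendsto_integral_Ioi a hg.integrableOn tendsto_id
  simp only [h.integral_eq, id] at h1
  have h2 := h1.add_const (f a)
  simp only [sub_add_cancel] at h2
  have h3 := IntegrableAtFilter.eq_zero_of_tendsto (μ := volume) (hf.integrableAtFilter atTop)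
    (fun s hs => ?_) h2
  · linarith
  · obtain ⟨b, hb⟩ := mem_atTop_sets.1 hs
    exact eq_top_mono (measure_mono fun x hx => hb x hx) (Real.volume_Ici (a := b))

theorem integral_Iic (h : IsPrimitive f g) (hf : Integrable f) (hg : Integrable g) (a : ℝ) :
    ∫ x in Iic a, g x = f a := by
  have h1 := intervalIntegral_tendsto_integral_Iic a hg.integrableOn tendsto_id
  simp only [h.integral_eq, id] at h1
  have h2 := h1.const_sub (f a)
  simp only [sub_sub_cancel] at h2
  have h3 := IntegrableAtFilter.eq_zero_of_tendsto (μ := volume) (hf.integrableAtFilter atBot)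
    (fun s hs => ?_) h2
  · linarith
  · obtain ⟨b, hb⟩ := mem_atBot_sets.1 hs
    exact eq_top_mono (measure_mono fun x hx => hb x hx) (Real.volume_Iic (a := b))

theorem integral_eq_zero (h : IsPrimitive f g) (hf : Integrable f) (hg : Integrable g) :
    ∫ x, g x = 0 := by
  rw [← intervalIntegral.integral_Iic_add_Ioi (b := 0) hg.integrableOn hg.integrableOn,
    h.integral_Iic hf hg, h.integral_Ioi hf hg]
  ring

theorem isWeakDeriv (h : IsPrimitive f g) : IsWeakDeriv f g := by
  refine ⟨h.continuous.locallyIntegrable, h.locallyIntegrable, fun φ hφ hc => ?_⟩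
  have hφ' : Continuous (deriv φ) := hφ.continuous_deriv (by simp)
  have hp : IsPrimitive φ (deriv φ) :=
    of_hasDerivAt (fun x => (hφ.differentiable (by simp) x).hasDerivAt) hφ'
  have hi1 : Integrable fun x => g x * φ x := by
    simpa [mul_comm] using
      h.locallyIntegrable.integrable_smul_left_of_hasCompactSupport hφ.continuous hc
  have hi2 : Integrable fun x => f x * deriv φ x :=
    (h.continuous.mul hφ').integrable_of_hasCompactSupport hc.deriv.mul_left
  have := (h.mul hp).integral_eq_zero
    ((h.continuous.mul hφ.continuous).integrable_of_hasCompactSupport hc.mul_left)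
    (hi1.add hi2)
  rw [integral_add hi1 hi2] at this
  linarith

end IsPrimitive

/-- The primitive started left of the support vanishes again to the right of it, because the total
mass is zero. -/
theorem exists_compactSupport_primitive {χ : ℝ → ℝ} (hχ : ContDiff ℝ ∞ χ)
    (hc : HasCompactSupport χ) (h0 : ∫ x, χ x = 0) :
    ∃ φ : ℝ → ℝ, ContDiff ℝ ∞ φ ∧ HasCompactSupport φ ∧ deriv φ = χ := by
  have hp := IsPrimitive.integral hχ.continuous.locallyIntegrable
  obtain ⟨R, hz⟩ : ∃ R, ∀ x, R ≤ |x| → χ x = 0 := by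
    obtain ⟨R, hR⟩ := hc.isBounded.subset_closedBall 0
    refine ⟨R + 1, fun x hx => image_eq_zero_of_notMem_tsupport fun h => ?_⟩
    have := hR h
    rw [mem_closedBall_zero_iff, Real.norm_eq_abs] at this
    linarith
  have hd := (hp (-R)).hasDerivAt hχ.continuous
  have hderiv : deriv (fun x => ∫ t in (-R)..x, χ t) = χ := funext fun x => (hd x).deriv
  refine ⟨fun x => ∫ t in (-R)..x, χ t, ?_, ?_, hderiv⟩
  · refine contDiff_infty_iff_deriv.2 ⟨fun x => (hd x).differentiableAt, ?_⟩
    rwa [hderiv]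
  · refine HasCompactSupport.intro (isCompact_Icc (a := -R) (b := R)) fun x hx => ?_
    rcases lt_or_ge x (-R) with h | h
    · rw [intervalIntegral.integral_congr (g := fun _ => 0)]
      · simp
      · intro t ht
        rw [uIcc_of_ge h.le] at ht
        exact hz t (by linarith [ht.2, neg_le_abs t])
    · have hx' : R < x := by
        by_contra! hh
        exact hx ⟨h, hh⟩
      rw [intervalIntegral.integral_of_le h, setIntegral_eq_integral_of_forall_compl_eq_zero, h0]
      intro t ht
      rw [mem_Ioc, not_and_or, not_lt, not_le] at ht
      rcases ht with ht | ht
      · exact hz t (by linarith [neg_le_abs t])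
      · exact hz t (by linarith [le_abs_self t])

/-- A continuous function with vanishing weak derivative is constant. -/
theorem IsWeakDeriv.eq_const {k : ℝ → ℝ} (hk : Continuous k) (h : IsWeakDeriv k fun _ => 0) :
    ∃ c, ∀ x, k x = c := by
  let b : ContDiffBump (0 : ℝ) := ⟨1, 2, one_pos, one_lt_two⟩
  set η : ℝ → ℝ := b.normed volume
  have hη : ContDiff ℝ ∞ η := b.contDiff_normed
  have hηc : HasCompactSupport η := b.hasCompactSupport_normed
  have hη1 : ∫ x, η x = 1 := b.integral_normed
  have hint : ∀ {p q : ℝ → ℝ}, Continuous p → Continuous q → HasCompactSupport q →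
      Integrable fun x => p x * q x := fun hp hq hc =>
    (hp.mul hq).integrable_of_hasCompactSupport hc.mul_left
  refine ⟨∫ x, k x * η x, fun x => ?_⟩
  have hae : k =ᵐ[volume] fun _ => ∫ x, k x * η x := by
    refine ae_eq_of_integral_contDiff_smul_eq hk.locallyIntegrable
      continuous_const.locallyIntegrable fun ψ hψ hψc => ?_
    have hψi : Integrable ψ := hψ.continuous.integrable_of_hasCompactSupport hψc
    have hηi : Integrable η := hη.continuous.integrable_of_hasCompactSupport hηc
    -- Subtracting `(∫ ψ) η` makes the mean zero, so the difference is the derivative of a test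
    -- function and `k` integrates to zero against it.
    obtain ⟨φ, hφ, hφc, hφ'⟩ := exists_compactSupport_primitive
      (χ := fun x => ψ x - (∫ y, ψ y) * η x) (hψ.sub (contDiff_const.mul hη))
      (hψc.sub hηc.mul_left)
      (by rw [integral_sub hψi (hηi.const_mul _), integral_const_mul, hη1]; ring)
    have h2 := h.2.2 φ hφ hφc
    simp only [hφ', zero_mul, integral_zero, neg_zero, mul_sub] at h2
    have h3 : ∀ x, k x * ((∫ y, ψ y) * η x) = (∫ y, ψ y) * (k x * η x) := fun x => by ring
    simp only [h3] at h2
    rw [integral_sub (hint hk hψ.continuous hψc) ((hint hk hη.continuous hηc).const_mul _),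
      integral_const_mul] at h2
    simp only [smul_eq_mul, integral_mul_const, mul_comm (ψ _) (k _)]
    linarith
  exact congrFun ((Continuous.ae_eq_iff_eq volume hk continuous_const).1 hae) x

/-- The difference between `f` and an integral of `g` is continuous with zero weak derivative, hence
constant. -/
theorem IsWeakDeriv.isPrimitive {f g : ℝ → ℝ} (hf : Continuous f) (h : IsWeakDeriv f g) :
    IsPrimitive f g := by
  have hp := IsPrimitive.integral h.2.1 0
  have hw := hp.isWeakDeriv
  obtain ⟨c, hc⟩ := IsWeakDeriv.eq_const (k := fun x => f x - ∫ t in (0 : ℝ)..x, g t)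
    (hf.sub hp.continuous) ⟨h.1.sub hw.1, continuous_const.locallyIntegrable, fun φ hφ hφc => by
      have hi : ∀ {p : ℝ → ℝ}, LocallyIntegrable p volume →
          Integrable fun x => p x * deriv φ x := fun hp => by
        simpa [mul_comm] using hp.integrable_smul_left_of_hasCompactSupport
          (hφ.continuous_deriv (by simp)) hφc.deriv
      simp only [sub_mul, zero_mul, integral_zero, neg_zero]
      rw [integral_sub (hi h.1) (hi hw.1), h.2.2 φ hφ hφc, hw.2.2 φ hφ hφc, sub_self]⟩
  refine IsPrimitive.of_base (a := 0) h.2.1 fun x => ?_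
  have h0 := hc 0
  have hx := hc x
  simp only [intervalIntegral.integral_same] at h0
  linarith

/-! ### Bounded solutions of the Riccati equation. -/

/-- The exponentially weighted average of `h` over `(-∞, x]`; it solves `f' = h - c f`. -/
noncomputable def expAverage (c : ℝ) (h : ℝ → ℝ) (x : ℝ) : ℝ :=
  Real.exp (-c * x) * ∫ t in Iic x, Real.exp (c * t) * h t

section expAverage

variable {c : ℝ} {h h' : ℝ → ℝ} {m M : ℝ}

theorem integrableOn_exp_mul_Iic_mul (hc : 0 < c) (hm : AEStronglyMeasurable h volume)
    (hb : ∀ᵐ t, h t ∈ Icc m M) (x : ℝ) :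
    IntegrableOn (fun t => Real.exp (c * t) * h t) (Iic x) := by
  refine Integrable.mul_bdd (c := max |m| |M|) (integrableOn_exp_mul_Iic hc x) hm.restrict
    (ae_restrict_of_ae ?_)
  filter_upwards [hb] with t ht
  exact abs_le_max_abs_abs ht.1 ht.2

/-- The kernel `exp (c (t - x))` is positive with mass `1 / c` on `(-∞, x]`, so bounds on `h` pass
to the average. -/
theorem expAverage_mem_Icc (hc : 0 < c) (hm : AEStronglyMeasurable h volume)
    (hb : ∀ᵐ t, h t ∈ Icc m M) (x : ℝ) : expAverage c h x ∈ Icc (m / c) (M / c) := by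
  have hi := integrableOn_exp_mul_Iic_mul hc hm hb x
  have he := integrableOn_exp_mul_Iic hc x
  have key : ∀ k : ℝ, Real.exp (-c * x) * ∫ t in Iic x, Real.exp (c * t) * k = k / c := fun k => by
    rw [integral_mul_const, integral_exp_mul_Iic hc, div_mul_eq_mul_div, mul_div_assoc', ← mul_assoc,
      ← Real.exp_add]
    simp
  rw [← key m, ← key M]
  constructor <;> refine mul_le_mul_of_nonneg_left ?_ (Real.exp_pos _).le
  · refine setIntegral_mono_ae (he.mul_const m) hi (hb.mono fun t ht => ?_)
    exact mul_le_mul_of_nonneg_left ht.1 (Real.exp_pos _).le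
  · refine setIntegral_mono_ae hi (he.mul_const M) (hb.mono fun t ht => ?_)
    exact mul_le_mul_of_nonneg_left ht.2 (Real.exp_pos _).le

theorem expAverage_sub (hc : 0 < c) {m' M' : ℝ} (hm : AEStronglyMeasurable h volume)
    (hb : ∀ᵐ t, h t ∈ Icc m M) (hm' : AEStronglyMeasurable h' volume)
    (hb' : ∀ᵐ t, h' t ∈ Icc m' M') (x : ℝ) :
    expAverage c h x - expAverage c h' x = expAverage c (fun t => h t - h' t) x := by
  simp only [expAverage, mul_sub]
  rw [integral_sub (integrableOn_exp_mul_Iic_mul hc hm hb x)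
    (integrableOn_exp_mul_Iic_mul hc hm' hb' x), mul_sub]

theorem expAverage_isPrimitive (hc : 0 < c) (hm : AEStronglyMeasurable h volume)
    (hb : ∀ᵐ t, h t ∈ Icc m M) :
    IsPrimitive (expAverage c h) (fun x => h x - c * expAverage c h x) := by
  have hi := integrableOn_exp_mul_Iic_mul hc hm hb
  have h1 : IsPrimitive (fun x => Real.exp (-c * x)) (fun x => Real.exp (-c * x) * -c) :=
    IsPrimitive.of_hasDerivAt
      (fun x => by simpa using ((hasDerivAt_id x).const_mul (-c)).exp) (by fun_prop)
  have h2 : IsPrimitive (fun x => ∫ t in Iic x, Real.exp (c * t) * h t)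
      (fun x => Real.exp (c * x) * h x) := by
    refine ⟨locallyIntegrable_of_intervalIntegrable fun a b => ?_, fun a b => ?_⟩
    · exact ⟨(hi b).mono_set Ioc_subset_Iic_self, (hi a).mono_set Ioc_subset_Iic_self⟩
    · rw [intervalIntegral.integral_Iic_sub_Iic (hi a) (hi b)]
  refine (h1.mul h2).congr_ae (Eventually.of_forall fun x => ?_)
  have : Real.exp (-c * x) * Real.exp (c * x) = 1 := by
    rw [← Real.exp_add]
    simp
  simp only [expAverage]
  linear_combination h x * this

end expAverage

/-- The Riccati equation `l' = V - l²` has a global solution between `√v₀` and `√v₁`. -/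
theorem exists_riccati {V : ℝ → ℝ} {v₀ v₁ : ℝ} (hV : AEStronglyMeasurable V volume) (hv₀ : 0 < v₀)
    (hbd : ∀ᵐ x : ℝ, v₀ ≤ V x ∧ V x ≤ v₁) :
    ∃ l : ℝ → ℝ, (∀ x, l x ∈ Icc √v₀ √v₁) ∧ IsPrimitive l (fun x => V x - l x ^ 2) := by
  obtain ⟨x₀, hx₀⟩ := hbd.exists
  have h01 : v₀ ≤ v₁ := hx₀.1.trans hx₀.2
  set α := √v₀
  set β := √v₁
  have hα0 : 0 < α := Real.sqrt_pos.2 hv₀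
  have hαβ : α ≤ β := Real.sqrt_le_sqrt h01
  have hα2 : α ^ 2 = v₀ := Real.sq_sqrt hv₀.le
  have hβ2 : β ^ 2 = v₁ := Real.sq_sqrt (hv₀.le.trans h01)
  have hβ0 : 0 < β := hα0.trans_le hαβ
  -- The equation is rewritten as `l' + c l = V + c l - l²` and solved as a fixed point of
  -- `expAverage`. With `c = 2β` the map `s ↦ c s - s²` is nondecreasing on `[α, β]`, so the right
  -- side stays in `[c α, c β]`.
  set c := 2 * β with hc_def
  have hc : 0 < c := by positivity
  let X := BoundedContinuousFunction ℝ (Icc α β)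
  have : CompleteSpace (Icc α β) := isClosed_Icc.completeSpace_coe
  have : Nonempty X := ⟨BoundedContinuousFunction.const ℝ ⟨α, le_rfl, hαβ⟩⟩
  let H : X → ℝ → ℝ := fun l t => V t + c * (l t : ℝ) - (l t : ℝ) ^ 2
  have hcont : ∀ l : X, Continuous fun t => (l t : ℝ) := fun l =>
    continuous_subtype_val.comp l.continuous
  have hHm : ∀ l, AEStronglyMeasurable (H l) volume := fun l =>
    (hV.add ((hcont l).const_mul c).aestronglyMeasurable).sub
      ((hcont l).pow 2).aestronglyMeasurable
  have hHb : ∀ l, ∀ᵐ t, H l t ∈ Icc (c * α) (c * β) := fun l => by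
    filter_upwards [hbd] with t ht
    obtain ⟨h1, h2⟩ := (l t).2
    constructor <;> simp only [H, hc_def] <;> nlinarith
  have hT : ∀ l x, expAverage c (H l) x ∈ Icc α β := fun l x => by
    have := expAverage_mem_Icc hc (hHm l) (hHb l) x
    rwa [mul_div_cancel_left₀ _ hc.ne', mul_div_cancel_left₀ _ hc.ne'] at this
  have hP := fun l => expAverage_isPrimitive hc (hHm l) (hHb l)
  let T : X → X := fun l =>
    ⟨⟨fun x => ⟨expAverage c (H l) x, hT l x⟩, (hP l).continuous.subtype_mk _⟩,
      β - α, fun x y => Real.dist_le_of_mem_Icc (hT l x) (hT l y)⟩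
  -- The Lipschitz constant of `s ↦ c s - s²` on `[α, β]` is at most `c - 2α`, and averaging divides
  -- by `c`: the ratio is `(c - 2α) / c = 1 - α / β`.
  obtain ⟨k, hk⟩ : ∃ k : NNReal, (k : ℝ) = 1 - α / β :=
    ⟨_, Real.coe_toNNReal _ (sub_nonneg.2 ((div_le_one hβ0).2 hαβ))⟩
  have hcontr : ContractingWith k T := by
    refine ⟨?_, LipschitzWith.of_dist_le_mul fun l l' => ?_⟩
    · rw [← NNReal.coe_lt_coe, hk]
      exact sub_lt_self _ (div_pos hα0 hβ0)
    · refine (BoundedContinuousFunction.dist_le (by positivity)).2 fun x => ?_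
      have hd : ∀ᵐ t, H l t - H l' t ∈
          Icc (-((c - 2 * α) * dist l l')) ((c - 2 * α) * dist l l') := by
        refine Eventually.of_forall fun t => ?_
        have h1 : |(l t : ℝ) - l' t| ≤ dist l l' :=
          BoundedContinuousFunction.dist_coe_le_dist (f := l) (g := l') t
        have h2 : H l t - H l' t = (c - (l t + l' t)) * ((l t : ℝ) - l' t) := by
          simp only [H]
          ring
        have h3 : |c - (l t + l' t : ℝ)| ≤ c - 2 * α := by
          rw [abs_of_nonneg (by linarith [(l t).2.2, (l' t).2.2])]
          linarith [(l t).2.1, (l' t).2.1]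
        rw [mem_Icc, ← abs_le, h2, abs_mul]
        exact mul_le_mul h3 h1 (abs_nonneg _) ((abs_nonneg _).trans h3)
      have := expAverage_mem_Icc hc ((hHm l).sub (hHm l')) hd x
      rw [neg_div, mem_Icc, ← abs_le] at this
      change |expAverage c (H l) x - expAverage c (H l') x| ≤ k * dist l l'
      rw [hk, expAverage_sub hc (hHm l) (hHb l) (hHm l') (hHb l')]
      refine this.trans_eq ?_
      rw [hc_def]
      field_simp
  let l := ContractingWith.fixedPoint T hcontr
  have hl : T l = l := hcontr.fixedPoint_isFixedPt
  have hlx : expAverage c (H l) = fun x => (l x : ℝ) := funext fun x =>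
    congrArg Subtype.val (DFunLike.congr_fun hl x)
  refine ⟨fun x => l x, fun x => (l x).2, ?_⟩
  have := hP l
  rw [hlx] at this
  refine this.congr_ae (Eventually.of_forall fun x => ?_)
  simp only [H]
  ring

/-- The reflection `x ↦ -l (-x)` carries solutions for `V (-x)` to solutions for `V` and reverses
the sign. -/
theorem exists_riccati_neg {V : ℝ → ℝ} {v₀ v₁ : ℝ} (hV : AEStronglyMeasurable V volume)
    (hv₀ : 0 < v₀) (hbd : ∀ᵐ x : ℝ, v₀ ≤ V x ∧ V x ≤ v₁) :
    ∃ r : ℝ → ℝ, (∀ x, -r x ∈ Icc √v₀ √v₁) ∧ IsPrimitive r (fun x => V x - r x ^ 2) := by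
  have hneg := (Measure.measurePreserving_neg (volume : Measure ℝ)).quasiMeasurePreserving
  obtain ⟨l, hl, hp⟩ := exists_riccati (V := fun x => V (-x))
    (hV.comp_quasiMeasurePreserving hneg) hv₀ (hneg.ae hbd)
  refine ⟨fun x => -l (-x), fun x => by simpa using hl (-x), ?_⟩
  simpa using hp.comp_neg

/-! ### Completing the square, and the candidate minimizer. -/

theorem integrable_mul_sq {V w : ℝ → ℝ} (hV : MemLp V ⊤ volume) (hw : MemLp w 2 volume) :
    Integrable fun x => V x * w x ^ 2 :=
  hw.integrable_sq.mul_of_top_right hV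

/-- Completing the square with a bounded solution of the Riccati equation, on both half-lines. -/
theorem integral_eq_of_riccati {V ρ w g : ℝ → ℝ} {B : ℝ} (hV : MemLp V ⊤ volume)
    (hρ : IsPrimitive ρ fun x => V x - ρ x ^ 2) (hB : ∀ x, |ρ x| ≤ B)
    (hp : IsPrimitive w g) (hw : MemLp w 2 volume) (hg : MemLp g 2 volume) (a : ℝ) :
    Integrable (fun x => g x ^ 2 + V x * w x ^ 2) ∧ Integrable (fun x => (g x - ρ x * w x) ^ 2) ∧
    ∫ x in Ioi a, (g x ^ 2 + V x * w x ^ 2) =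
      -(ρ a * w a ^ 2) + ∫ x in Ioi a, (g x - ρ x * w x) ^ 2 ∧
    ∫ x in Iic a, (g x ^ 2 + V x * w x ^ 2) =
      ρ a * w a ^ 2 + ∫ x in Iic a, (g x - ρ x * w x) ^ 2 := by
  have hρw : MemLp (fun x => ρ x * w x) 2 volume := by
    refine hw.of_le_mul (c := B) (hρ.continuous.aestronglyMeasurable.mul hw.1)
      (Eventually.of_forall fun x => ?_)
    rw [norm_mul]
    exact mul_le_mul_of_nonneg_right (hB x) (norm_nonneg _)
  have hN : Integrable fun x => g x ^ 2 + V x * w x ^ 2 :=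
    hg.integrable_sq.add (integrable_mul_sq hV hw)
  have hD : Integrable fun x => (g x - ρ x * w x) ^ 2 := (hg.sub hρw).integrable_sq
  have hf : Integrable fun x => ρ x * (w x * w x) := by
    simp only [← mul_assoc]
    exact hρw.integrable_mul hw
  have hprim : IsPrimitive (fun x => ρ x * (w x * w x))
      (fun x => (g x ^ 2 + V x * w x ^ 2) - (g x - ρ x * w x) ^ 2) :=
    (hρ.mul (hp.mul hp)).congr_ae (Eventually.of_forall fun x => by dsimp only; ring)
  refine ⟨hN, hD, ?_, ?_⟩
  · have := hprim.integral_Ioi hf (hN.sub hD) a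
    rw [integral_sub hN.integrableOn hD.integrableOn] at this
    rw [sq (w a)]
    linarith
  · have := hprim.integral_Iic hf (hN.sub hD) a
    rw [integral_sub hN.integrableOn hD.integrableOn] at this
    rw [sq (w a)]
    linarith

/-- The function equal to `1` at `a` with logarithmic derivative `l` on the left of `a` and `r` on
the right of `a`. -/
noncomputable def profile (l r : ℝ → ℝ) (a x : ℝ) : ℝ :=
  if x ≤ a then Real.exp (∫ t in a..x, l t) else Real.exp (∫ t in a..x, r t)

section profile

variable {l r : ℝ → ℝ} {a : ℝ}

theorem profile_self : profile l r a a = 1 := by simp [profile]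

theorem profile_of_le {x : ℝ} (hx : x ≤ a) : profile l r a x = Real.exp (∫ t in a..x, l t) :=
  if_pos hx

theorem profile_of_ge {x : ℝ} (hx : a ≤ x) : profile l r a x = Real.exp (∫ t in a..x, r t) := by
  rcases hx.eq_or_lt with rfl | hx
  · simp [profile]
  · exact if_neg hx.not_ge

theorem hasDerivAt_exp_integral (hr : Continuous r) (a x : ℝ) :
    HasDerivAt (fun x => Real.exp (∫ t in a..x, r t)) (r x * Real.exp (∫ t in a..x, r t)) x := by
  have := ((IsPrimitive.integral hr.locallyIntegrable a).hasDerivAt hr x).exp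
  rwa [mul_comm] at this

theorem exp_integral_isPrimitive (hr : Continuous r) (a : ℝ) :
    IsPrimitive (fun x => Real.exp (∫ t in a..x, r t))
      (fun x => r x * Real.exp (∫ t in a..x, r t)) :=
  IsPrimitive.of_hasDerivAt (hasDerivAt_exp_integral hr a)
    (hr.mul (IsPrimitive.integral hr.locallyIntegrable a).continuous.rexp)

theorem profile_isPrimitive (hl : Continuous l) (hr : Continuous r) (a : ℝ) :
    IsPrimitive (profile l r a) (fun x => (if x ≤ a then l x else r x) * profile l r a x) := by
  have h := (exp_integral_isPrimitive hl a).ite_le (exp_integral_isPrimitive hr a) (a := a) (by simp)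
  refine IsPrimitive.congr_ae (f := profile l r a) h (Eventually.of_forall fun x => ?_)
  by_cases hx : x ≤ a
  · simp only [if_pos hx, profile_of_le hx]
  · simp only [if_neg hx, profile_of_ge (le_of_not_ge hx)]

theorem profile_hasDerivWithinAt_Ioi (hr : Continuous r) :
    HasDerivWithinAt (profile l r a) (r a) (Ioi a) a := by
  have := (hasDerivAt_exp_integral hr a a).hasDerivWithinAt (s := Ioi a)
  simp only [intervalIntegral.integral_same, Real.exp_zero, mul_one] at this
  exact this.congr (fun x hx => profile_of_ge (le_of_lt hx)) (profile_of_ge le_rfl)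

theorem profile_hasDerivWithinAt_Iio (hl : Continuous l) :
    HasDerivWithinAt (profile l r a) (l a) (Iio a) a := by
  have := (hasDerivAt_exp_integral hl a a).hasDerivWithinAt (s := Iio a)
  simp only [intervalIntegral.integral_same, Real.exp_zero, mul_one] at this
  exact this.congr (fun x hx => profile_of_le (le_of_lt hx)) (profile_of_le le_rfl)

theorem profile_pos (x : ℝ) : 0 < profile l r a x := by
  unfold profile
  split_ifs <;> exact Real.exp_pos _

theorem profile_le_exp {α : ℝ} (hl : Continuous l) (hr : Continuous r) (hlα : ∀ x, α ≤ l x)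
    (hrα : ∀ x, r x ≤ -α) (x : ℝ) : profile l r a x ≤ Real.exp (-α * |x - a|) := by
  rcases le_total x a with hx | hx
  · rw [profile_of_le hx, Real.exp_le_exp, intervalIntegral.integral_symm,
      abs_of_nonpos (by linarith)]
    have := intervalIntegral.integral_mono hx (intervalIntegrable_const (μ := volume) (c := α))
      (hl.intervalIntegrable x a) hlα
    rw [intervalIntegral.integral_const, smul_eq_mul] at this
    linarith
  · rw [profile_of_ge hx, Real.exp_le_exp, abs_of_nonneg (by linarith)]
    have := intervalIntegral.integral_mono hx (hr.intervalIntegrable a x)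
      (intervalIntegrable_const (μ := volume) (c := -α)) hrα
    rw [intervalIntegral.integral_const, smul_eq_mul] at this
    linarith

theorem integrable_exp_neg_mul_abs_sub {κ : ℝ} (hκ : 0 < κ) (a : ℝ) :
    Integrable fun x : ℝ => Real.exp (-κ * |x - a|) := by
  suffices h : Integrable fun x : ℝ => Real.exp (-κ * |x|) from h.comp_sub_right a
  rw [← integrableOn_univ, ← Iic_union_Ioi (a := (0 : ℝ)), integrableOn_union]
  constructor
  · refine (integrableOn_exp_mul_Iic hκ 0).congr_fun (fun x hx => ?_) measurableSet_Iic
    simp only [abs_of_nonpos (mem_Iic.1 hx)]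
    ring_nf
  · refine (integrableOn_exp_mul_Ioi (neg_lt_zero.2 hκ) 0).congr_fun (fun x hx => ?_)
      measurableSet_Ioi
    simp only [abs_of_pos (mem_Ioi.1 hx)]

end profile

/-- If the essential supremum were at most some `c < 1`, the set `{c < |u|}` would be null, yet it
is open and contains `a`. -/
theorem eLpNorm_top_eq_one {u : ℝ → ℝ} {a : ℝ} (hu : Continuous u) (ha : u a = 1)
    (h : ∀ x, |u x| ≤ 1) : eLpNorm u ⊤ volume = 1 := by
  rw [eLpNorm_exponent_top]
  refine le_antisymm (eLpNormEssSup_le_of_ae_bound (C := 1) (Eventually.of_forall h) |>.trans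
    (by simp)) (le_of_forall_lt fun c hc => ?_)
  by_contra! hle
  have hae : ∀ᵐ x, ‖u x‖ₑ ≤ c := (ae_le_eLpNormEssSup (f := u)).mono fun x hx => hx.trans hle
  have hopen : IsOpen {x | c < ‖u x‖ₑ} := isOpen_lt continuous_const hu.enorm
  have hmem : a ∈ {x | c < ‖u x‖ₑ} := by simpa [ha] using hc
  refine (hopen.measure_pos volume ⟨a, hmem⟩).ne' ?_
  simpa [ae_iff] using hae

/-! ### Existence, uniqueness and value of the minimum. -/

/-- Bounded global solutions `l > 0` and `r < 0` of the Riccati equation `f' = V - f²`. -/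
structure IsRiccatiPair (V l r : ℝ → ℝ) (α β : ℝ) : Prop where
  pos : 0 < α
  left_mem : ∀ x, l x ∈ Icc α β
  right_mem : ∀ x, -r x ∈ Icc α β
  left : IsPrimitive l fun x => V x - l x ^ 2
  right : IsPrimitive r fun x => V x - r x ^ 2

namespace IsRiccatiPair

variable {V l r : ℝ → ℝ} {α β : ℝ}

theorem abs_left_le (h : IsRiccatiPair V l r α β) (x : ℝ) : |l x| ≤ β := by
  rw [abs_of_pos (h.pos.trans_le (h.left_mem x).1)]
  exact (h.left_mem x).2

theorem abs_right_le (h : IsRiccatiPair V l r α β) (x : ℝ) : |r x| ≤ β := by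
  rw [← abs_neg, abs_of_pos (h.pos.trans_le (h.right_mem x).1)]
  exact (h.right_mem x).2

theorem profile_le_exp (h : IsRiccatiPair V l r α β) (a x : ℝ) :
    profile l r a x ≤ Real.exp (-α * |x - a|) :=
  SobolevPotential.profile_le_exp h.left.continuous h.right.continuous (fun x => (h.left_mem x).1)
    (fun x => by linarith [(h.right_mem x).1]) x

theorem memLp_profile (h : IsRiccatiPair V l r α β) (a : ℝ) :
    MemLp (profile l r a) 2 volume := by
  have hc := (profile_isPrimitive h.left.continuous h.right.continuous a).continuous
  rw [memLp_two_iff_integrable_sq hc.aestronglyMeasurable]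
  refine (integrable_exp_neg_mul_abs_sub (κ := 2 * α) (by linarith [h.pos]) a).mono'
    (hc.pow 2).aestronglyMeasurable (Eventually.of_forall fun x => ?_)
  rw [norm_pow, Real.norm_of_nonneg (profile_pos x).le]
  refine (pow_le_pow_left₀ (profile_pos x).le (h.profile_le_exp a x) 2).trans_eq ?_
  rw [← Real.exp_nat_mul]
  push_cast
  ring_nf

theorem memLp_profile_deriv (h : IsRiccatiPair V l r α β) (a : ℝ) :
    MemLp (fun x => (if x ≤ a then l x else r x) * profile l r a x) 2 volume := by
  have hp := profile_isPrimitive h.left.continuous h.right.continuous a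
  refine (h.memLp_profile a).of_le_mul (c := β) hp.locallyIntegrable.aestronglyMeasurable
    (Eventually.of_forall fun x => ?_)
  rw [norm_mul]
  refine mul_le_mul_of_nonneg_right ?_ (norm_nonneg _)
  split_ifs
  exacts [h.abs_left_le x, h.abs_right_le x]

theorem profile_mem_K (h : IsRiccatiPair V l r α β) (a : ℝ) : profile l r a ∈ K a := by
  have hp := profile_isPrimitive h.left.continuous h.right.continuous a
  refine ⟨⟨hp.continuous, h.memLp_profile a, _, hp.isWeakDeriv, h.memLp_profile_deriv a⟩,
    profile_self, eLpNorm_top_eq_one hp.continuous profile_self fun x => ?_⟩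
  rw [abs_of_pos (profile_pos x)]
  refine (h.profile_le_exp a x).trans (Real.exp_le_one_iff.2 ?_)
  nlinarith [h.pos, abs_nonneg (x - a)]

/-- Of the constraints on `w` at the peak, only `w a = 1` enters; it turns the boundary terms into
`l a - r a`. -/
theorem normSqV_eq (h : IsRiccatiPair V l r α β) (hV : MemLp V ⊤ volume) {w g : ℝ → ℝ} {a : ℝ}
    (hw : w ∈ K a) (hg : IsWeakDeriv w g) (hg2 : MemLp g 2 volume) :
    normSqV V w = l a - r a + (∫ x in Iic a, (g x - l x * w x) ^ 2) +
      ∫ x in Ioi a, (g x - r x * w x) ^ 2 := by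
  have hp := hg.isPrimitive hw.1.1
  obtain ⟨hi, -, -, h1⟩ := integral_eq_of_riccati hV h.left h.abs_left_le hp hw.1.2.1 hg2 a
  obtain ⟨-, -, h2, -⟩ := integral_eq_of_riccati hV h.right h.abs_right_le hp hw.1.2.1 hg2 a
  have hcongr : normSqV V w = ∫ x, (g x ^ 2 + V x * w x ^ 2) :=
    integral_congr_ae <| (hg.weakDeriv.ae_eq hg).mono fun x hx => by simp only [hx]
  rw [hcongr, ← intervalIntegral.integral_Iic_add_Ioi (b := a) hi.integrableOn hi.integrableOn,
    h1, h2, hw.2.1]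
  ring

theorem normSqV_profile (h : IsRiccatiPair V l r α β) (hV : MemLp V ⊤ volume) (a : ℝ) :
    normSqV V (profile l r a) = l a - r a := by
  have hp := profile_isPrimitive h.left.continuous h.right.continuous a
  rw [h.normSqV_eq hV (h.profile_mem_K a) hp.isWeakDeriv (h.memLp_profile_deriv a),
    setIntegral_eq_zero_of_forall_eq_zero, setIntegral_eq_zero_of_forall_eq_zero]
  · ring
  · intro x hx
    simp [(mem_Ioi.1 hx).not_ge]
  · intro x hx
    simp [mem_Iic.1 hx]

theorem le_normSqV (h : IsRiccatiPair V l r α β) (hV : MemLp V ⊤ volume) {w : ℝ → ℝ} {a : ℝ}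
    (hw : w ∈ K a) : l a - r a ≤ normSqV V w := by
  obtain ⟨g, hg, hg2⟩ := hw.1.2.2
  rw [h.normSqV_eq hV hw hg hg2, add_assoc]
  exact le_add_of_nonneg_right (add_nonneg (integral_nonneg fun x => sq_nonneg _)
    (integral_nonneg fun x => sq_nonneg _))

end IsRiccatiPair

/-- Uniqueness for the linear equation `w' = ρ w` on a set containing the interval between `a`
and `x`. -/
theorem IsPrimitive.eq_exp_integral {w g ρ : ℝ → ℝ} {s : Set ℝ} {a x : ℝ} (hw : IsPrimitive w g)
    (hρ : Continuous ρ) (hs : uIoc a x ⊆ s) (hms : MeasurableSet s)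
    (h : ∀ᵐ t ∂volume.restrict s, g t = ρ t * w t) :
    w x = w a * Real.exp (∫ t in a..x, ρ t) := by
  -- Integrating factor: `w` times `exp (-∫ ρ)` has zero derivative a.e. between `a` and `x`.
  have hE := exp_integral_isPrimitive hρ.neg a
  have h1 := (hw.mul hE).integral_eq a x
  rw [intervalIntegral.integral_congr_ae (g := fun _ => 0)] at h1
  · simp only [intervalIntegral.integral_zero, intervalIntegral.integral_same, Real.exp_zero,
      mul_one, Pi.neg_apply, intervalIntegral.integral_neg] at h1
    rw [← sub_eq_zero.1 h1.symm, mul_assoc, ← Real.exp_add]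
    simp
  · rw [ae_restrict_iff' hms] at h
    filter_upwards [h] with t ht hts
    rw [ht (hs hts)]
    simp only [Pi.neg_apply]
    ring

theorem ae_eq_of_setIntegral_sq_eq_zero {f : ℝ → ℝ} {s : Set ℝ}
    (hf : Integrable fun x => f x ^ 2) (h : ∫ x in s, f x ^ 2 = 0) :
    ∀ᵐ x ∂volume.restrict s, f x = 0 := by
  have := (integral_eq_zero_iff_of_nonneg (fun x => sq_nonneg (f x)) hf.integrableOn).1 h
  exact this.mono fun x hx => by simpa using hx

namespace IsRiccatiPair

variable {V l r : ℝ → ℝ} {α β : ℝ}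

/-- Equality kills both square terms, leaving a first-order linear equation on each side of `a` with
the value `1` at `a`. -/
theorem eq_profile (h : IsRiccatiPair V l r α β) (hV : MemLp V ⊤ volume) {w : ℝ → ℝ} {a : ℝ}
    (hw : w ∈ K a) (hle : normSqV V w ≤ l a - r a) : w = profile l r a := by
  obtain ⟨g, hg, hg2⟩ := hw.1.2.2
  have hp := hg.isPrimitive hw.1.1
  have hil := (integral_eq_of_riccati hV h.left h.abs_left_le hp hw.1.2.1 hg2 a).2.1
  have hir := (integral_eq_of_riccati hV h.right h.abs_right_le hp hw.1.2.1 hg2 a).2.1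
  rw [h.normSqV_eq hV hw hg hg2] at hle
  have h1 : 0 ≤ ∫ x in Iic a, (g x - l x * w x) ^ 2 := integral_nonneg fun x => sq_nonneg _
  have h2 : 0 ≤ ∫ x in Ioi a, (g x - r x * w x) ^ 2 := integral_nonneg fun x => sq_nonneg _
  have hl := ae_eq_of_setIntegral_sq_eq_zero hil (by linarith)
  have hr := ae_eq_of_setIntegral_sq_eq_zero hir (by linarith)
  funext x
  rcases le_total x a with hx | hx
  · rw [profile_of_le hx, hp.eq_exp_integral h.left.continuous (s := Iic a) ?_ measurableSet_Iic
      (hl.mono fun t ht => sub_eq_zero.1 ht), hw.2.1, one_mul]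
    rw [uIoc_of_ge hx]
    exact Ioc_subset_Iic_self
  · rw [profile_of_ge hx, hp.eq_exp_integral h.right.continuous (s := Ioi a) ?_ measurableSet_Ioi
      (hr.mono fun t ht => sub_eq_zero.1 ht), hw.2.1, one_mul]
    rw [uIoc_of_le hx]
    exact Ioc_subset_Ioi_self

theorem isMinimizer_iff (h : IsRiccatiPair V l r α β) (hV : MemLp V ⊤ volume) {w : ℝ → ℝ} {a : ℝ} :
    IsMinimizer V a w ↔ w = profile l r a := by
  constructor
  · rintro ⟨hw, hmin⟩
    exact h.eq_profile hV hw ((hmin _ (h.profile_mem_K a)).trans_eq (h.normSqV_profile hV a))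
  · rintro rfl
    exact ⟨h.profile_mem_K a, fun w hw => (h.normSqV_profile hV a).trans_le (h.le_normSqV hV hw)⟩

theorem F_eq (h : IsRiccatiPair V l r α β) (hV : MemLp V ⊤ volume) :
    F V = fun a => l a - r a := by
  funext a
  refine IsLeast.csInf_eq ⟨⟨_, h.profile_mem_K a, h.normSqV_profile hV a⟩, ?_⟩
  rintro _ ⟨w, hw, rfl⟩
  exact h.le_normSqV hV hw

end IsRiccatiPair

theorem exists_isRiccatiPair {V : ℝ → ℝ} {v₀ v₁ : ℝ} (hV : AEStronglyMeasurable V volume)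
    (hv₀ : 0 < v₀) (hbd : ∀ᵐ x : ℝ, v₀ ≤ V x ∧ V x ≤ v₁) :
    ∃ l r, IsRiccatiPair V l r √v₀ √v₁ := by
  obtain ⟨l, hl, hl'⟩ := exists_riccati hV hv₀ hbd
  obtain ⟨r, hr, hr'⟩ := exists_riccati_neg hV hv₀ hbd
  exact ⟨l, r, Real.sqrt_pos.2 hv₀, hl, hr, hl', hr'⟩

/-! ### Regularity of `F`. -/

theorem memLinftyLoc_of_continuous {f : ℝ → ℝ} (hf : Continuous f) : MemLinftyLoc f := by
  intro s hs
  obtain ⟨C, hC⟩ := hs.exists_bound_of_continuousOn hf.continuousOn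
  exact memLp_top_of_bound hf.aestronglyMeasurable C
    (ae_restrict_of_forall_mem hs.measurableSet hC)

theorem memLinftyLoc_mul {f g : ℝ → ℝ} (hf : MemLinftyLoc f) (hg : MemLinftyLoc g) :
    MemLinftyLoc fun x => f x * g x := fun s hs => (hg s hs).mul' (hf s hs)

namespace IsRiccatiPair

variable {V l r : ℝ → ℝ} {α β : ℝ}

theorem sub_isPrimitive (h : IsRiccatiPair V l r α β) :
    IsPrimitive (fun a => l a - r a) (fun a => r a ^ 2 - l a ^ 2) :=
  (h.left.sub h.right).congr_ae (Eventually.of_forall fun x => by dsimp only; ring)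

/-- The Riccati equations give `2 r (V - r²) - 2 l (V - l²)`, from which `l - r` factors out. -/
theorem sq_sub_sq_isPrimitive (h : IsRiccatiPair V l r α β) :
    IsPrimitive (fun a => r a ^ 2 - l a ^ 2)
      (fun a => 2 * (l a - r a) * (r a ^ 2 + r a * l a + l a ^ 2 - V a)) := by
  simp only [sq (r _), sq (l _)]
  exact ((h.right.mul h.right).sub (h.left.mul h.left)).congr_ae
    (Eventually.of_forall fun x => by dsimp only; ring)

end IsRiccatiPair

end SobolevPotential

theorem mainTheorem4 (V : ℝ → ℝ) (v₀ v₁ : ℝ) (hV : MemLp V ⊤ volume) (hv₀ : 0 < v₀)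
    (hbd : ∀ᵐ x : ℝ, v₀ ≤ V x ∧ V x ≤ v₁) :
    -- `u a` is the unique minimizer over `K_a`; `r a`, `l a` are its right and left
    -- derivatives at `a`.
    ∃ (u : ℝ → ℝ → ℝ) (r l : ℝ → ℝ),
      (∀ a w, SobolevPotential.IsMinimizer V a w ↔ w = u a) ∧
      (∀ a, SobolevPotential.F V a = SobolevPotential.normSqV V (u a)) ∧
      (∀ a, HasDerivWithinAt (u a) (r a) (Ioi a) a) ∧
      (∀ a, HasDerivWithinAt (u a) (l a) (Iio a) a) ∧
      SobolevPotential.MemW2inftyLoc (SobolevPotential.F V) ∧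
      (∀ a, SobolevPotential.F V a = l a - r a) ∧
      (∀ a, HasDerivAt (SobolevPotential.F V) (|r a| ^ 2 - |l a| ^ 2) a) ∧
      -- the formula for the second derivative, in the weak sense and pointwise a.e.
      SobolevPotential.IsWeakDeriv (deriv (SobolevPotential.F V))
        (fun a => 2 * SobolevPotential.F V a * (|r a| ^ 2 + r a * l a + |l a| ^ 2 - V a)) ∧
      (∀ᵐ a : ℝ, HasDerivAt (deriv (SobolevPotential.F V))
        (2 * SobolevPotential.F V a * (|r a| ^ 2 + r a * l a + |l a| ^ 2 - V a)) a) ∧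
      (Continuous V → ContDiff ℝ 2 (SobolevPotential.F V)) := by
  obtain ⟨l, r, h⟩ := SobolevPotential.exists_isRiccatiPair hV.1 hv₀ hbd
  have hl := h.left.continuous
  have hr := h.right.continuous
  -- `V` cancels in `l' - r'`, so the derivative `r² - l²` is continuous and is attained at every
  -- point.
  have hF' := h.sub_isPrimitive.hasDerivAt (by fun_prop)
  have hF'' := h.sq_sub_sq_isPrimitive
  have hderiv : deriv (fun a => l a - r a) = fun a => r a ^ 2 - l a ^ 2 :=
    funext fun a => (hF' a).deriv
  refine ⟨SobolevPotential.profile l r, r, l, fun a w => h.isMinimizer_iff hV, ?_⟩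
  simp only [h.F_eq hV, h.normSqV_profile hV, hderiv, sq_abs, implies_true, true_and]
  refine ⟨fun a => SobolevPotential.profile_hasDerivWithinAt_Ioi hr,
    fun a => SobolevPotential.profile_hasDerivWithinAt_Iio hl,
    ⟨hl.sub hr, _, _, h.sub_isPrimitive.isWeakDeriv, hF''.isWeakDeriv,
      SobolevPotential.memLinftyLoc_of_continuous (by fun_prop),
      SobolevPotential.memLinftyLoc_of_continuous (by fun_prop), ?_⟩,
    hF', hF''.isWeakDeriv, hF''.ae_hasDerivAt, fun hVc => ?_⟩
  -- In the second derivative every term is continuous except `V`, which is bounded by hypothesis.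
  · refine SobolevPotential.memLinftyLoc_mul
      (SobolevPotential.memLinftyLoc_of_continuous (by fun_prop)) fun s hs => ?_
    exact (SobolevPotential.memLinftyLoc_of_continuous
      (f := fun a => r a ^ 2 + r a * l a + l a ^ 2) (by fun_prop) s hs).sub (hV.restrict s)
  · have hF2 := hF''.hasDerivAt (by fun_prop)
    rw [show (2 : WithTop ℕ∞) = 1 + 1 from rfl, contDiff_succ_iff_deriv, hderiv]
    refine ⟨fun a => (hF' a).differentiableAt, by simp, ?_⟩
    rw [contDiff_one_iff_deriv]
    refine ⟨fun a => (hF2 a).differentiableAt, ?_⟩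
    rw [funext fun a => (hF2 a).deriv]
    fun_prop
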